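/- Let $\lambda=(\lambda_n)_{n\ge 1}$ be a frequency, i.e. a strictly increasing sequence of non-negative real numbers tending to $+\infty$, and suppose that $\lambda$ satisfies Bohr's condition $$(BC)\qquad \exists\, l>0\ \ \forall\, \delta>0\ \ \exists\, c>0\ \ \forall\, n\in\mathbb N:\quad \lambda_{n+1}-\lambda_n\ \ge\ c\,e^{-(l+\delta)\lambda_n}.$$ A $\lambda$-Dirichlet group is a pair $(G,\beta)$, where $G$ is a compact (Hausdorff) abelian group and $\beta\colon(\mathbb R,+)\to G$ is a continuous group homomorphism with dense range such that for every $n$ there is a (necessarily unique) continuous character $h_{\lambda_n}\colon G\to\mathbb T$ with $h_{\lambda_n}(\beta(t))=e^{-i\lambda_n t}$ for all $t\in\mathbb R$. Let $G$ carry its normalized (regular) Haar measure $m$, put $\widehat f(\gamma)=\int_G f\,\overline{\gamma}\,dm$ for $f\in L_1(G)$ and $\gamma\in\widehat G$, and let $H_p^\lambda(G)$ be the space of all $f\in L_p(G)$ with $\widehat f(\gamma)=0$ for every $\gamma\in\widehat G\setminus\{h_{\lambda_n}: n\in\mathbb N\}$. Then for every $u>0$ there is a constant $C=C(u,\lambda)>0$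 such that for every $\lambda$-Dirichlet group $(G,\beta)$, every $1\le p\le\infty$ and every $f\in H_p^\lambda(G)$ $$\Big\|\sup_{N}\Big|\sum_{n=1}^{N}\widehat f(h_{\lambda_n})\,e^{-\lambda_n u}\,h_{\lambda_n}\Big|\,\Big\|_p\ \le\ C\,\|f\|_p .$$ In particular, the maximal operator is bounded from $H_p^\lambda(G)$ to $L_p(G)$ also for $p=1$, with a bound that is uniform in $p$ and in $(G,\beta)$. -/

import Mathlib

open MeasureTheory Filter Topology
open scoped ENNReal ComplexConjugate

/-- A frequency: a strictly increasing sequence of non-negative reals tending to `+∞`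
(indexed by `ℕ`, starting at `0`). -/
structure IsFrequency (lam : ℕ → ℝ) : Prop where
  strictMono : StrictMono lam
  nonneg : ∀ n, 0 ≤ lam n
  tendsto_atTop : Tendsto lam atTop atTop

/-- Bohr's condition `(BC)`. -/
def BohrCondition (lam : ℕ → ℝ) : Prop :=
  ∃ l : ℝ, 0 < l ∧ ∀ δ : ℝ, 0 < δ → ∃ C : ℝ, 0 < C ∧ ∀ n : ℕ,
    C * Real.exp (-((l + δ) * lam n)) ≤ lam (n + 1) - lam n

section Groups

variable {G : Type*} [CommGroup G] [TopologicalSpace G]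

/-- `(G, β)` is a Dirichlet group (for a compact abelian group `G`): the homomorphism
`β : (ℝ, +) → G` is continuous and has dense range. -/
structure IsDirichletGroup (β : Multiplicative ℝ →* G) : Prop where
  continuous : Continuous β
  denseRange : DenseRange β

/-- The continuous character `γ` of `G` satisfies `γ ∘ β = e^{-i x ·}` on `ℝ`. -/
def IsCharacterAt (β : Multiplicative ℝ →* G) (x : ℝ) (γ : PontryaginDual G) : Prop :=
  ∀ t : ℝ, ((γ (β (Multiplicative.ofAdd t)) : Circle) : ℂ) =
    Complex.exp (-(Complex.I * (x : ℂ) * (t : ℂ)))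

/-- `(G, β)` is a `lam`-Dirichlet group: a Dirichlet group such that for every `n` there is a
character `h` of `G` with `h ∘ β = e^{-i lam n ·}`. -/
structure IsLambdaDirichletGroup (lam : ℕ → ℝ) (β : Multiplicative ℝ →* G) : Prop
    extends IsDirichletGroup β where
  exists_character : ∀ n, ∃ γ : PontryaginDual G, IsCharacterAt β (lam n) γ

/-- In a Dirichlet group there is at most one character with `γ ∘ β = e^{-i x ·}`. -/
theorem IsDirichletGroup.character_unique {β : Multiplicative ℝ →* G} (hβ : IsDirichletGroup β)
    {x : ℝ} {γ γ' : PontryaginDual G} (h : IsCharacterAt β x γ) (h' : IsCharacterAt β x γ') :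
    γ = γ' := by
  have key : (γ : G → Circle) = γ' := by
    refine hβ.denseRange.equalizer (map_continuous γ) (map_continuous γ') ?_
    funext t
    apply Circle.ext
    exact (h t.toAdd).trans (h' t.toAdd).symm
  exact DFunLike.coe_injective key

/-- The character `h_{lam n}` of a `lam`-Dirichlet group. -/
noncomputable def IsLambdaDirichletGroup.character {lam : ℕ → ℝ} {β : Multiplicative ℝ →* G}
    (hβ : IsLambdaDirichletGroup lam β) (n : ℕ) : PontryaginDual G :=
  (hβ.exists_character n).choose

theorem IsLambdaDirichletGroup.character_spec {lam : ℕ → ℝ} {β : Multiplicative ℝ →* G}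
    (hβ : IsLambdaDirichletGroup lam β) (n : ℕ) :
    IsCharacterAt β (lam n) (hβ.character n) :=
  (hβ.exists_character n).choose_spec

end Groups

section Hardy

variable {G : Type*} [CommGroup G] [TopologicalSpace G] [IsTopologicalGroup G] [CompactSpace G]
  [MeasurableSpace G] [BorelSpace G]

/-- The normalized Haar measure of a compact group (the regular Haar measure giving the whole
group mass `1`). -/
noncomputable def normalizedHaar (G : Type*) [CommGroup G] [TopologicalSpace G]
    [IsTopologicalGroup G] [CompactSpace G] [MeasurableSpace G] [BorelSpace G] : Measure G :=
  Measure.haarMeasure (⊤ : TopologicalSpace.PositiveCompacts G)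

/-- The Fourier coefficient `∫ f(ω) conj(γ(ω)) dω` of a function `f` on `G` at the character `γ`. -/
noncomputable def charFourierCoeff (f : G → ℂ) (γ : PontryaginDual G) : ℂ :=
  ∫ ω, f ω * conj ((γ ω : Circle) : ℂ) ∂(normalizedHaar G)

/-- The Hardy space `H_p^lam(G)`: all `f ∈ L_p(G)` whose Fourier transform is supported on
`{h_{lam n} : n}`. -/
def hardySpace {lam : ℕ → ℝ} {β : Multiplicative ℝ →* G} (hβ : IsLambdaDirichletGroup lam β)
    (p : ℝ≥0∞) : Set (Lp ℂ p (normalizedHaar G)) :=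
  {f | ∀ γ : PontryaginDual G, (∀ n, γ ≠ hβ.character n) → charFourierCoeff f γ = 0}

/-- The maximal function `ω ↦ sup_N |∑_{n < N} f̂(h_{lam n}) e^{-lam n u} h_{lam n}(ω)|`,
with values in `[0, ∞]`. -/
noncomputable def translatedMaximal {lam : ℕ → ℝ} {β : Multiplicative ℝ →* G}
    (hβ : IsLambdaDirichletGroup lam β) (u : ℝ) (f : G → ℂ) (ω : G) : ℝ≥0∞ :=
  ⨆ N : ℕ, ‖∑ n ∈ Finset.range N, charFourierCoeff f (hβ.character n) *
    (Real.exp (-(lam n * u)) : ℂ) * ((hβ.character n ω : Circle) : ℂ)‖ₑ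

end Hardy

/-! Along the flow of `β` the character `h_{λ_n}` oscillates with frequency `λ_n`, so integrating
translates of `f` along the flow against a kernel `k` on `ℝ` multiplies each coefficient of `f` by a
value of the Fourier transform of `k`. The weighted partial sum ending at `a = λ_N` is therefore
such an average whenever the transform of `k` is `e^{-ux}` on `[0, a]` and vanishes at all later
frequencies. Bohr's condition leaves a gap of length `d = c e^{-La}` in which to descend linearly to
zero.

The steep ramp costs a factor `d^{-θ}` in the decay `|s|^{-(1+θ)}` of the kernel, but it has height
only `e^{-ua}`. For `θ = u/L` the two balance, and all kernels share one integrable majorant `Φ`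
(`norm_integral_expCutoff_le`, `exists_kernel_truncating_exp`). The supremum over `N` is then
dominated by a single positive average with weight `Φ`, bounded on every `L_p` by translation
invariance; no weak-type maximal theorem enters, so `p = 1` is not special.

`G` need not be second countable, so joint measurability along the flow is delicate. `f` is
therefore first convolved with a trigonometric polynomial `K` of `L_1`-norm one whose coefficients
are almost `1` at the first `M` characters (`exists_trigPoly_approx_identity`). Schur's test
(`eLpNorm_lintegral_kernel_le`) bounds the average, the smoothing error is at most `‖f‖_1`, and `M →
∞` by monotone convergence. -/

/-! ### The truncated exponential and the decay of its Fourier transform -/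

/-- The function `e^{-u|x|}` up to `a`, continued linearly to `0` on `[a, a + d]` and by `0`
afterwards. -/
noncomputable def expCutoff (u a d x : ℝ) : ℝ :=
  Real.exp (-(u * |min x a|)) * max 0 (1 - max 0 ((x - a) / d))

theorem continuous_expCutoff (u a d : ℝ) : Continuous (expCutoff u a d) := by
  unfold expCutoff
  fun_prop

theorem expCutoff_nonneg (u a d x : ℝ) : 0 ≤ expCutoff u a d x := by
  unfold expCutoff
  positivity

theorem expCutoff_of_le {u a d x : ℝ} (hd : 0 < d) (hx : x ≤ a) :
    expCutoff u a d x = Real.exp (-(u * |x|)) := by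
  have : (x - a) / d ≤ 0 := div_nonpos_of_nonpos_of_nonneg (by linarith) hd.le
  simp [expCutoff, min_eq_left hx, max_eq_left this]

theorem expCutoff_of_mem_Icc {u a d x : ℝ} (ha : 0 ≤ a) (hd : 0 < d) (hx : a ≤ x)
    (hx' : x ≤ a + d) :
    expCutoff u a d x = Real.exp (-(u * a)) * (1 - (x - a) / d) := by
  have h1 : 0 ≤ (x - a) / d := div_nonneg (by linarith) hd.le
  have h2 : (x - a) / d ≤ 1 := (div_le_one hd).2 (by linarith)
  rw [expCutoff, min_eq_right hx, max_eq_right h1, max_eq_right (by linarith), abs_of_nonneg ha]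

theorem expCutoff_of_ge {u a d x : ℝ} (hd : 0 < d) (hx : a + d ≤ x) : expCutoff u a d x = 0 := by
  have h1 : 1 ≤ (x - a) / d := (one_le_div hd).2 (by linarith)
  have h2 : (0 : ℝ) ≤ (x - a) / d := by linarith
  rw [expCutoff, max_eq_right h2, max_eq_left (by linarith), mul_zero]

theorem expCutoff_le {u a d : ℝ} (hu : 0 < u) (ha : 0 ≤ a) (hd : 0 < d) (hd1 : d ≤ 1) (x : ℝ) :
    expCutoff u a d x ≤ Real.exp u * Real.exp (-(u * |x|)) := by
  rw [← Real.exp_add]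
  rcases le_total x a with h | h
  · rw [expCutoff_of_le hd h]
    gcongr
    linarith
  rcases le_total x (a + d) with h' | h'
  · rw [expCutoff_of_mem_Icc ha hd h h', abs_of_nonneg (ha.trans h)]
    have h1 : 0 ≤ (x - a) / d := div_nonneg (by linarith) hd.le
    calc Real.exp (-(u * a)) * (1 - (x - a) / d) ≤ Real.exp (-(u * a)) * 1 := by
          gcongr
          linarith
      _ ≤ _ := by
          rw [mul_one]
          gcongr
          -- On the ramp `x ≤ a + d ≤ a + 1`, which is where the factor `e^u` comes from.
          nlinarith
  · rw [expCutoff_of_ge hd h']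
    positivity

theorem integrable_exp_neg_mul_abs {u : ℝ} (hu : 0 < u) :
    Integrable fun x : ℝ => Real.exp (-(u * |x|)) := by
  rw [← integrableOn_univ, ← Set.Iic_union_Ioi (a := (0 : ℝ)), integrableOn_union]
  constructor
  · refine (integrableOn_exp_mul_Iic hu 0).congr_fun (fun x hx => ?_) measurableSet_Iic
    simp [abs_of_nonpos (Set.mem_Iic.1 hx)]
  · refine (integrableOn_exp_mul_Ioi (neg_lt_zero.2 hu) 0).congr_fun (fun x hx => ?_)
      measurableSet_Ioi
    simp [abs_of_pos (Set.mem_Ioi.1 hx)]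

theorem integrable_expCutoff {u a d : ℝ} (hu : 0 < u) (ha : 0 ≤ a) (hd : 0 < d) (hd1 : d ≤ 1) :
    Integrable (expCutoff u a d) :=
  ((integrable_exp_neg_mul_abs hu).const_mul (Real.exp u)).mono'
    (continuous_expCutoff u a d).aestronglyMeasurable
    (ae_of_all _ fun x => by
      rw [Real.norm_of_nonneg (expCutoff_nonneg u a d x)]
      exact expCutoff_le hu ha hd hd1 x)

theorem integral_one_sub_mul_cexp {a d : ℝ} (hd : 0 < d) {z : ℂ} (hz : z ≠ 0) :
    ∫ x in a..a + d, (1 - ((x : ℂ) - a) / d) * Complex.exp (z * x) =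
      Complex.exp (z * a) * (-1 / z + (Complex.exp (z * d) - 1) / (d * z ^ 2)) := by
  have hd' : (d : ℂ) ≠ 0 := by exact_mod_cast hd.ne'
  -- The antiderivative comes from one integration by parts.
  have key : ∀ x ∈ Set.uIcc a (a + d), HasDerivAt
      (fun x : ℝ => (1 - ((x : ℂ) - a) / d) * (Complex.exp (z * x) / z) +
        Complex.exp (z * x) / (d * z ^ 2))
      ((1 - ((x : ℂ) - a) / d) * Complex.exp (z * x)) x := by
    intro x _
    have e : HasDerivAt (fun x : ℝ => Complex.exp (z * x)) (Complex.exp (z * x) * (z * 1)) x :=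
      ((Complex.ofRealCLM.hasDerivAt (x := x)).const_mul z).cexp
    have l : HasDerivAt (fun x : ℝ => 1 - ((x : ℂ) - a) / d) (-(1 / d)) x :=
      (((Complex.ofRealCLM.hasDerivAt (x := x)).sub_const (a : ℂ)).div_const (d : ℂ)).const_sub 1
    refine ((l.mul (e.div_const z)).add (e.div_const (d * z ^ 2))).congr_deriv ?_
    field_simp
    ring
  rw [intervalIntegral.integral_eq_sub_of_hasDerivAt key
    (Continuous.intervalIntegrable (by fun_prop) _ _)]
  push_cast
  rw [mul_add, Complex.exp_add]
  field_simp
  ring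

/-- The first two terms are the transform of the full `e^{-u|x|}`; the rest is the correction due to
the cut. Pairing `1 / (z - u)` with `1 / z` exhibits the cancellation that continuity at `a`
provides: only the last quotient, coming from the ramp, depends badly on `d`. -/
theorem integral_expCutoff_mul_cexp {u a d : ℝ} (hu : 0 < u) (ha : 0 ≤ a) (hd : 0 < d)
    (hd1 : d ≤ 1) {z : ℂ} (hz : z ≠ 0) (hre : z.re = 0) :
    ∫ x : ℝ, (expCutoff u a d x : ℂ) * Complex.exp (z * x) =
      1 / (z + u) - 1 / (z - u) + Real.exp (-(u * a)) * Complex.exp (z * a) *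
        (1 / (z - u) - 1 / z + (Complex.exp (z * d) - 1) / (d * z ^ 2)) := by
  have hzu : z + u ≠ 0 := fun h => by
    have := congrArg Complex.re h
    simp [hre] at this
    exact hu.ne' this
  have hzu' : z - u ≠ 0 := fun h => by
    have := congrArg Complex.re h
    simp [hre] at this
    exact hu.ne' this
  have hint : Integrable fun x : ℝ => (expCutoff u a d x : ℂ) * Complex.exp (z * x) := by
    refine (integrable_expCutoff hu ha hd hd1).mono ?_ (ae_of_all _ fun x => ?_)
    · have := continuous_expCutoff u a d
      exact Continuous.aestronglyMeasurable (by fun_prop)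
    · simp [Complex.norm_exp, hre]
  have hcont : Continuous fun x : ℝ => (expCutoff u a d x : ℂ) * Complex.exp (z * x) := by
    have := continuous_expCutoff u a d
    fun_prop
  rw [← intervalIntegral.integral_Iic_add_Ioi (b := a + d) hint.integrableOn hint.integrableOn]
  have h0 : ∫ x in Set.Ioi (a + d), (expCutoff u a d x : ℂ) * Complex.exp (z * x) = 0 :=
    setIntegral_eq_zero_of_forall_eq_zero fun x hx => by
      simp [expCutoff_of_ge hd (le_of_lt hx)]
  have h1 : ∫ x in Set.Iic (0 : ℝ), (expCutoff u a d x : ℂ) * Complex.exp (z * x) =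
      1 / (z + u) := by
    rw [setIntegral_congr_fun (g := fun x : ℝ => Complex.exp ((z + u) * x)) measurableSet_Iic,
      integral_exp_mul_complex_Iic (by simp [hre, hu])]
    · simp
    · intro x hx
      have hx : x ≤ 0 := hx
      simp only [expCutoff_of_le hd (hx.trans ha), abs_of_nonpos hx]
      push_cast
      rw [← Complex.exp_add]
      ring_nf
  have h2 : ∫ x in (0 : ℝ)..a, (expCutoff u a d x : ℂ) * Complex.exp (z * x) =
      (Complex.exp (z * a) * Real.exp (-(u * a)) - 1) / (z - u) := by
    rw [intervalIntegral.integral_congr (g := fun x : ℝ => Complex.exp ((z - u) * x)),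
      integral_exp_mul_complex hzu']
    · push_cast
      rw [← Complex.exp_add]
      simp only [mul_zero, Complex.exp_zero]
      ring_nf
    · intro x hx
      rw [Set.uIcc_of_le ha] at hx
      simp only [expCutoff_of_le hd hx.2, abs_of_nonneg hx.1]
      push_cast
      rw [← Complex.exp_add]
      ring_nf
  have h3 : ∫ x in a..a + d, (expCutoff u a d x : ℂ) * Complex.exp (z * x) =
      Real.exp (-(u * a)) * (Complex.exp (z * a) *
        (-1 / z + (Complex.exp (z * d) - 1) / (d * z ^ 2))) := by
    rw [← integral_one_sub_mul_cexp hd hz, ← intervalIntegral.integral_const_mul]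
    refine intervalIntegral.integral_congr fun x hx => ?_
    rw [Set.uIcc_of_le (by linarith)] at hx
    simp only [expCutoff_of_mem_Icc ha hd hx.1 hx.2]
    push_cast
    ring
  have h4 := intervalIntegral.integral_Iic_sub_Iic (a := 0) (b := a + d) hint.integrableOn
    hint.integrableOn
  have h5 := intervalIntegral.integral_add_adjacent_intervals (hcont.intervalIntegrable 0 a)
    (hcont.intervalIntegrable (μ := volume) a (a + d))
  rw [sub_eq_iff_eq_add.1 h4, ← h5, h0, h1, h2, h3]
  ring

/-- Interpolates between the Lipschitz bound `y` and the trivial bound `2`. -/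
theorem norm_cexp_mul_I_sub_one_le {y θ : ℝ} (hy : 0 < y) (h0 : 0 ≤ θ) (h1 : θ ≤ 1) {w : ℂ}
    (hw : w.re = 0) (hwy : ‖w‖ = y) : ‖Complex.exp w - 1‖ ≤ 2 * y ^ (1 - θ) := by
  have hw' : w = Complex.I * (w.im : ℂ) := by
    apply Complex.ext <;> simp [hw]
  have hyp : 0 < y ^ (1 - θ) := Real.rpow_pos_of_pos hy _
  rcases le_total y 1 with h | h
  · have : ‖Complex.exp w - 1‖ ≤ y := by
      rw [← hwy, hw']
      refine Real.norm_exp_I_mul_ofReal_sub_one_le.trans ?_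
      simp
    have h2 : y ≤ y ^ (1 - θ) := by
      conv_lhs => rw [← Real.rpow_one y]
      exact Real.rpow_le_rpow_of_exponent_ge hy h (by linarith)
    linarith
  · have h2 : 1 ≤ y ^ (1 - θ) := Real.one_le_rpow h (by linarith)
    have h3 : ‖Complex.exp w - 1‖ ≤ 2 := by
      refine (norm_sub_le _ _).trans ?_
      rw [Complex.norm_exp, hw]
      norm_num
    linarith

/-- On the imaginary axis `|z ± u| ≥ |z|`, so all differences of simple fractions are `O(|z|^{-2})`,
which `|z| ≥ 1` weakens to the exponent `-(1+θ)`. Interpolating the ramp quotient trades decay in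
`z` for a milder power of `d`. -/
theorem norm_integral_expCutoff_le {u a d θ : ℝ} (hu : 0 < u) (ha : 0 ≤ a) (hd : 0 < d)
    (hd1 : d ≤ 1) (h0 : 0 ≤ θ) (h1 : θ ≤ 1) {z : ℂ} (hz : 1 ≤ ‖z‖) (hre : z.re = 0) :
    ‖∫ x : ℝ, (expCutoff u a d x : ℂ) * Complex.exp (z * x)‖ ≤
      (3 * u + 2 * Real.exp (-(u * a)) * d ^ (-θ)) * ‖z‖ ^ (-(1 + θ)) := by
  have hz0 : z ≠ 0 := fun h => by simp [h] at hz; linarith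
  set t := ‖z‖ with ht
  have ht0 : 0 < t := by linarith
  have him : |z.im| = t := by
    rw [ht, ← Complex.abs_im_eq_norm.2 hre]
  have hp : t ≤ ‖z + u‖ := by
    rw [← him]
    simpa using Complex.abs_im_le_norm (z + u)
  have hm : t ≤ ‖z - u‖ := by
    rw [← him]
    simpa using Complex.abs_im_le_norm (z - u)
  have hzu : z + u ≠ 0 := norm_pos_iff.1 (ht0.trans_le hp)
  have hzu' : z - u ≠ 0 := norm_pos_iff.1 (ht0.trans_le hm)
  have htsq : t⁻¹ * t⁻¹ ≤ t ^ (-(1 + θ)) := by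
    have : t⁻¹ * t⁻¹ = t ^ (-2 : ℝ) := by
      rw [Real.rpow_neg ht0.le, Real.rpow_two, pow_two, mul_inv]
    rw [this]
    exact Real.rpow_le_rpow_of_exponent_le hz (by linarith)
  have e1 : ‖1 / (z + u) - 1 / (z - u)‖ ≤ 2 * u * t ^ (-(1 + θ)) := by
    have : 1 / (z + u) - 1 / (z - u) = -(2 * u) * ((z + u)⁻¹ * (z - u)⁻¹) := by
      field_simp
      ring
    rw [this, norm_mul, norm_mul, norm_inv, norm_inv]
    have h2u : ‖-(2 * (u : ℂ))‖ = 2 * u := by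
      rw [norm_neg, norm_mul, Complex.norm_real, Real.norm_of_nonneg hu.le]
      simp
    rw [h2u]
    refine mul_le_mul_of_nonneg_left (le_trans ?_ htsq) (by positivity)
    gcongr
  have e2 : ‖1 / (z - u) - 1 / z‖ ≤ u * t ^ (-(1 + θ)) := by
    have : 1 / (z - u) - 1 / z = u * ((z - u)⁻¹ * z⁻¹) := by
      field_simp
      ring
    rw [this, norm_mul, norm_mul, norm_inv, norm_inv, Complex.norm_real, Real.norm_of_nonneg hu.le]
    refine mul_le_mul_of_nonneg_left (le_trans ?_ htsq) (by positivity)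
    gcongr
  have e3 : ‖(Complex.exp (z * d) - 1) / (d * z ^ 2)‖ ≤ 2 * d ^ (-θ) * t ^ (-(1 + θ)) := by
    rw [norm_div, norm_mul, norm_pow, Complex.norm_real, Real.norm_of_nonneg hd.le, ← ht,
      div_le_iff₀ (by positivity)]
    refine (norm_cexp_mul_I_sub_one_le (y := t * d) (θ := θ) (by positivity) h0 h1
      (by simp [hre]) (by simp [ht, abs_of_pos hd])).trans (le_of_eq ?_)
    have ed : d ^ (1 - θ) = d * d ^ (-θ) := by
      rw [sub_eq_add_neg, Real.rpow_add hd, Real.rpow_one]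
    have et : t ^ (1 - θ) = t ^ 2 * t ^ (-(1 + θ)) := by
      rw [← Real.rpow_two, ← Real.rpow_add ht0]
      ring_nf
    rw [Real.mul_rpow ht0.le hd.le, ed, et]
    ring
  rw [integral_expCutoff_mul_cexp hu ha hd hd1 hz0 hre]
  have hexp : ‖Complex.exp (z * a)‖ = 1 := by simp [Complex.norm_exp, hre]
  have hexp' : ‖(Real.exp (-(u * a)) : ℂ)‖ = Real.exp (-(u * a)) := by
    rw [Complex.norm_real, Real.norm_of_nonneg (Real.exp_nonneg _)]
  have hle : Real.exp (-(u * a)) ≤ 1 := Real.exp_le_one_iff.2 (by nlinarith)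
  have hP : 0 < t ^ (-(1 + θ)) := Real.rpow_pos_of_pos ht0 _
  calc _ ≤ 2 * u * t ^ (-(1 + θ)) + Real.exp (-(u * a)) *
        (u * t ^ (-(1 + θ)) + 2 * d ^ (-θ) * t ^ (-(1 + θ))) := by
        refine (norm_add_le _ _).trans (add_le_add e1 ?_)
        rw [norm_mul, norm_mul, hexp, hexp', mul_one]
        exact mul_le_mul_of_nonneg_left ((norm_add_le _ _).trans (add_le_add e2 e3))
          (Real.exp_nonneg _)
    _ ≤ _ := by
        have : Real.exp (-(u * a)) * (u * t ^ (-(1 + θ))) ≤ 1 * (u * t ^ (-(1 + θ))) := by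
          gcongr
        linarith

/-! ### An integrable majorant independent of the cut point -/

open FourierTransform in
/-- Kernels on `ℝ` with a common integrable majorant whose Fourier transforms agree with
`e^{-ux}` up to `a` and vanish from `a + c e^{-La}` on. -/
theorem exists_kernel_truncating_exp {u L c : ℝ} (hu : 0 < u) (hL : u ≤ L) (hc : 0 < c)
    (hc1 : c ≤ 1) :
    ∃ Φ : ℝ → ℝ, Integrable Φ ∧ Continuous Φ ∧ (∀ s, 0 ≤ Φ s) ∧ ∀ a, 0 ≤ a → ∃ k : ℝ → ℂ,
      Integrable k ∧ (∀ s, ‖k s‖ ≤ Φ s) ∧ ∀ x : ℝ, 0 ≤ x →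
        (x ≤ a → ∫ s, k s * Complex.exp (2 * Real.pi * Complex.I * x * s) =
          Real.exp (-(x * u))) ∧
        (a + c * Real.exp (-(L * a)) ≤ x →
          ∫ s, k s * Complex.exp (2 * Real.pi * Complex.I * x * s) = 0) := by
  have hL0 : 0 < L := hu.trans_le hL
  -- This exponent makes `e^{-ua} d^{-θ} = c^{-θ}` for `d = c e^{-La}`, free of `a`; `u ≤ L` ensures
  -- `θ ≤ 1`.
  set θ := u / L with hθ
  have hθ0 : 0 < θ := div_pos hu hL0
  have hθ1 : θ ≤ 1 := (div_le_one hL0).2 hL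
  set I₀ := Real.exp u * ∫ x : ℝ, Real.exp (-(u * |x|)) with hI₀
  have hI₀' : 0 ≤ I₀ := mul_nonneg (Real.exp_nonneg _) (integral_nonneg fun x => Real.exp_nonneg _)
  set B := 3 * u + 2 * c ^ (-θ) with hB
  have hBpos : 0 < B := by positivity
  -- `I₀` controls `|s| ≤ 1` and `B` controls `|s| ≥ 1`. The factor `4` absorbs `2^{1+θ} ≤ 4` in
  -- both ranges.
  set Φ : ℝ → ℝ := fun s => 4 * (I₀ + B) * (1 + ‖s‖) ^ (-(1 + θ)) with hΦ
  have hΦi : Integrable Φ := (integrable_one_add_norm (by simp [hθ0])).const_mul _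
  have hΦc : Continuous Φ := by
    refine continuous_const.mul (Continuous.rpow_const (by fun_prop) fun s => Or.inl ?_)
    positivity
  refine ⟨Φ, hΦi, hΦc, fun s => by positivity, fun a ha => ?_⟩
  set d := c * Real.exp (-(L * a)) with hd
  have hd0 : 0 < d := by positivity
  have hd1 : d ≤ 1 := by
    have : Real.exp (-(L * a)) ≤ 1 := Real.exp_le_one_iff.2 (by nlinarith)
    nlinarith [Real.exp_nonneg (-(L * a))]
  set m : ℝ → ℂ := fun x => (expCutoff u a d x : ℂ) with hm
  have hmc : Continuous m := Complex.continuous_ofReal.comp (continuous_expCutoff u a d)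
  have hmi : Integrable m := (integrable_expCutoff hu ha hd0 hd1).ofReal
  have hk : ∀ s : ℝ, 𝓕 m s =
      ∫ x : ℝ, (expCutoff u a d x : ℂ) * Complex.exp ((-(2 * Real.pi * s) * Complex.I : ℂ) * x) := by
    intro s
    rw [Real.fourier_real_eq_integral_exp_smul]
    congr 1
    ext x
    rw [smul_eq_mul, mul_comm]
    simp only [hm]
    push_cast
    ring_nf
  have hnz : ∀ s : ℝ, ‖(-(2 * Real.pi * s) * Complex.I : ℂ)‖ = 2 * Real.pi * |s| := by
    intro s
    simp [abs_of_pos Real.pi_pos]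
  have hbound : ∀ s, ‖𝓕 m s‖ ≤ Φ s := by
    intro s
    rw [hk]
    have hs1 : 0 < 1 + ‖s‖ := by positivity
    rcases le_total |s| 1 with h | h
    · have h1 : ‖∫ x : ℝ, (expCutoff u a d x : ℂ) *
          Complex.exp ((-(2 * Real.pi * s) * Complex.I : ℂ) * x)‖ ≤ I₀ := by
        rw [hI₀, ← integral_const_mul]
        refine norm_integral_le_of_norm_le ((integrable_exp_neg_mul_abs hu).const_mul _)
          (ae_of_all _ fun x => ?_)
        rw [norm_mul, Complex.norm_exp, Complex.norm_real,
          Real.norm_of_nonneg (expCutoff_nonneg u a d x)]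
        simpa using expCutoff_le hu ha hd0 hd1 x
      have h2 : (1 : ℝ) / 4 ≤ (1 + ‖s‖) ^ (-(1 + θ)) := by
        calc (1 : ℝ) / 4 = 2 ^ (-2 : ℝ) := by
              rw [Real.rpow_neg (by norm_num), Real.rpow_two]
              norm_num
          _ ≤ 2 ^ (-(1 + θ)) := Real.rpow_le_rpow_of_exponent_le (by norm_num) (by linarith)
          _ ≤ _ := Real.rpow_le_rpow_of_nonpos hs1 (by rw [Real.norm_eq_abs]; linarith)
              (by linarith)
      refine h1.trans ?_
      simp only [hΦ]
      nlinarith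
    · have hpi : |s| ≤ 2 * Real.pi * |s| := by nlinarith [Real.pi_gt_three]
      have h1 := norm_integral_expCutoff_le (θ := θ) hu ha hd0 hd1 hθ0.le hθ1
        (z := (-(2 * Real.pi * s) * Complex.I : ℂ)) (by rw [hnz]; linarith) (by simp)
      rw [hnz] at h1
      refine h1.trans ?_
      have h2 : Real.exp (-(u * a)) * d ^ (-θ) = c ^ (-θ) := by
        rw [hd, Real.mul_rpow hc.le (Real.exp_nonneg _), ← Real.exp_mul, mul_left_comm,
          ← Real.exp_add]
        have : -(u * a) + -(L * a) * -θ = 0 := by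
          rw [hθ]
          field_simp
          ring
        rw [this, Real.exp_zero, mul_one]
      have h3 : 3 * u + 2 * Real.exp (-(u * a)) * d ^ (-θ) = B := by
        rw [mul_assoc, h2]
      rw [h3]
      have h4 : (2 * Real.pi * |s|) ^ (-(1 + θ)) ≤ 4 * (1 + ‖s‖) ^ (-(1 + θ)) := by
        calc (2 * Real.pi * |s|) ^ (-(1 + θ)) ≤ ((1 + ‖s‖) / 2) ^ (-(1 + θ)) := by
              refine Real.rpow_le_rpow_of_nonpos (by positivity) ?_ (by linarith)
              rw [Real.norm_eq_abs]
              linarith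
          _ = (1 + ‖s‖) ^ (-(1 + θ)) * 2 ^ (1 + θ) := by
              rw [Real.div_rpow hs1.le (by norm_num), Real.rpow_neg (by norm_num : (0 : ℝ) ≤ 2),
                div_inv_eq_mul]
          _ ≤ (1 + ‖s‖) ^ (-(1 + θ)) * 2 ^ (2 : ℝ) := by
              gcongr
              · norm_num
              · linarith
          _ = _ := by
              rw [Real.rpow_two]
              ring
      have h5 : 0 < (1 + ‖s‖) ^ (-(1 + θ)) := Real.rpow_pos_of_pos hs1 _
      simp only [hΦ]
      nlinarith
  have hki : Integrable (𝓕 m) := by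
    refine hΦi.mono' (Continuous.aestronglyMeasurable ?_) (ae_of_all _ hbound)
    exact VectorFourier.fourierIntegral_continuous Real.continuous_fourierChar
      (by fun_prop) hmi
  refine ⟨𝓕 m, hki, hbound, fun x hx => ?_⟩
  -- Fourier inversion applies: `m` is continuous and integrable, and its transform was just shown
  -- to be integrable.
  have hinv : ∫ s, 𝓕 m s * Complex.exp (2 * Real.pi * Complex.I * x * s) = m x := by
    rw [← hmi.fourierInv_fourier_eq hki hmc.continuousAt, Real.fourierInv_eq']
    congr 1
    ext s
    rw [smul_eq_mul, mul_comm]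
    congr 2
    simp
    ring
  rw [hinv]
  refine ⟨fun h => ?_, fun h => ?_⟩
  · simp only [hm, expCutoff_of_le hd0 h, abs_of_nonneg hx, mul_comm]
  · simp only [hm, expCutoff_of_ge hd0 h, Complex.ofReal_zero]

/-! ### Two tools on `L_p`: Schur's test and monotone limits -/

/-- **Schur's test** on `L_p` for a nonnegative kernel. -/
theorem eLpNorm_lintegral_kernel_le {X Y : Type*} [MeasurableSpace X] [MeasurableSpace Y]
    {μ : Measure X} {ν : Measure Y} [SFinite μ] [SFinite ν] {k : X → Y → ℝ≥0∞}
    (hk : Measurable (Function.uncurry k)) {A : ℝ≥0∞} (h1 : ∀ x, ∫⁻ y, k x y ∂ν ≤ A)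
    (h2 : ∀ y, ∫⁻ x, k x y ∂μ ≤ A) {g : Y → ℝ≥0∞} (hg : Measurable g) {p : ℝ≥0∞} (hp : 1 ≤ p) :
    eLpNorm (fun x => ∫⁻ y, k x y * g y ∂ν) p μ ≤ A * eLpNorm g p ν := by
  have hkx : ∀ x, Measurable (k x) := fun x => hk.comp measurable_prodMk_left
  have hky : ∀ y, Measurable fun x => k x y := fun y => hk.comp measurable_prodMk_right
  have swap : ∀ G : Y → ℝ≥0∞, Measurable G →
      ∫⁻ x, ∫⁻ y, k x y * G y ∂ν ∂μ ≤ A * ∫⁻ y, G y ∂ν := by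
    intro G hG
    rw [lintegral_lintegral_swap (Measurable.aemeasurable (hk.mul (hG.comp measurable_snd)))]
    calc ∫⁻ y, ∫⁻ x, k x y * G y ∂μ ∂ν ≤ ∫⁻ y, A * G y ∂ν := by
          refine lintegral_mono fun y => ?_
          rw [lintegral_mul_const _ (hky y)]
          gcongr
          exact h2 y
      _ = _ := lintegral_const_mul _ hG
  rcases eq_or_ne p ∞ with rfl | hp'
  · rw [eLpNorm_exponent_top, eLpNorm_exponent_top]
    refine essSup_le_of_ae_le _ (ae_of_all _ fun x => ?_)
    calc ∫⁻ y, k x y * g y ∂ν ≤ ∫⁻ y, k x y * eLpNormEssSup g ν ∂ν := by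
          refine lintegral_mono_ae ?_
          filter_upwards [enorm_ae_le_eLpNormEssSup g ν] with y hy
          exact mul_le_mul' le_rfl hy
      _ = (∫⁻ y, k x y ∂ν) * eLpNormEssSup g ν := lintegral_mul_const _ (hkx x)
      _ ≤ _ := mul_le_mul' (h1 x) le_rfl
  rcases eq_or_lt_of_le hp with rfl | hp1
  · rw [eLpNorm_one_eq_lintegral_enorm, eLpNorm_one_eq_lintegral_enorm]
    exact swap g hg
  have hp0 : p ≠ 0 := (zero_lt_one.trans hp1).ne'
  rw [eLpNorm_eq_lintegral_rpow_enorm_toReal hp0 hp', eLpNorm_eq_lintegral_rpow_enorm_toReal hp0 hp']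
  simp only [enorm_eq_self]
  set r := p.toReal with hr
  have hr1 : 1 < r := by
    rw [hr, ← ENNReal.toReal_one]
    exact (ENNReal.toReal_lt_toReal ENNReal.one_ne_top hp').2 hp1
  have hr0 : 0 < r := by linarith
  have hpq : r.HolderConjugate (Real.conjExponent r) := Real.HolderConjugate.conjExponent hr1
  set q := Real.conjExponent r with hq
  have hq0 : 0 < q := hpq.symm.pos
  -- Hölder for the splitting `k g = k^{1/q} · (k^{1/r} g)`.
  have holder : ∀ x, (∫⁻ y, k x y * g y ∂ν) ^ r ≤ A ^ (r / q) * ∫⁻ y, k x y * g y ^ r ∂ν := by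
    intro x
    have e1 := ENNReal.lintegral_mul_le_Lp_mul_Lq ν hpq.symm
      (f := fun y => k x y ^ (1 / q)) (g := fun y => k x y ^ (1 / r) * g y)
      ((hkx x).pow_const _).aemeasurable (((hkx x).pow_const _).mul hg).aemeasurable
    have e2 : ∀ y, ((fun y => k x y ^ (1 / q)) * fun y => k x y ^ (1 / r) * g y) y =
        k x y * g y := by
      intro y
      simp only [Pi.mul_apply]
      rw [← mul_assoc, ← ENNReal.rpow_add_of_nonneg _ _ (by positivity) (by positivity)]
      have : 1 / q + 1 / r = 1 := by
        simpa [one_div] using hpq.symm.inv_add_inv_eq_one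
      rw [this, ENNReal.rpow_one]
    have e3 : ∀ y, (k x y ^ (1 / q)) ^ q = k x y := fun y => by
      rw [← ENNReal.rpow_mul, one_div_mul_cancel hq0.ne', ENNReal.rpow_one]
    have e4 : ∀ y, (k x y ^ (1 / r) * g y) ^ r = k x y * g y ^ r := fun y => by
      rw [ENNReal.mul_rpow_of_nonneg _ _ hr0.le, ← ENNReal.rpow_mul, one_div_mul_cancel hr0.ne',
        ENNReal.rpow_one]
    simp only [e2, e3, e4] at e1
    calc (∫⁻ y, k x y * g y ∂ν) ^ r
        ≤ ((∫⁻ y, k x y ∂ν) ^ (1 / q) * (∫⁻ y, k x y * g y ^ r ∂ν) ^ (1 / r)) ^ r := by gcongr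
      _ = (∫⁻ y, k x y ∂ν) ^ (r / q) * ∫⁻ y, k x y * g y ^ r ∂ν := by
          rw [ENNReal.mul_rpow_of_nonneg _ _ hr0.le, ← ENNReal.rpow_mul, ← ENNReal.rpow_mul,
            one_div_mul_cancel hr0.ne', ENNReal.rpow_one, one_div_mul_eq_div]
      _ ≤ _ := by
          gcongr
          exact h1 x
  have hmain : ∫⁻ x, (∫⁻ y, k x y * g y ∂ν) ^ r ∂μ ≤ A ^ r * ∫⁻ y, g y ^ r ∂ν := by
    calc ∫⁻ x, (∫⁻ y, k x y * g y ∂ν) ^ r ∂μ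
        ≤ ∫⁻ x, A ^ (r / q) * ∫⁻ y, k x y * g y ^ r ∂ν ∂μ := lintegral_mono holder
      _ = A ^ (r / q) * ∫⁻ x, ∫⁻ y, k x y * g y ^ r ∂ν ∂μ := by
          refine lintegral_const_mul _ (Measurable.lintegral_prod_right' (f := fun z : X × Y =>
            k z.1 z.2 * g z.2 ^ r) ?_)
          exact hk.mul ((hg.pow_const r).comp measurable_snd)
      _ ≤ A ^ (r / q) * (A * ∫⁻ y, g y ^ r ∂ν) := by
          gcongr
          exact swap _ (hg.pow_const r)
      _ = A ^ r * ∫⁻ y, g y ^ r ∂ν := by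
          have h : r / q + 1 = r := by
            have := hpq.inv_add_inv_eq_one
            field_simp at this ⊢
            linarith
          rw [← mul_assoc]
          congr 1
          conv_lhs => rw [← ENNReal.rpow_one A, ← ENNReal.rpow_mul, one_mul]
          rw [← ENNReal.rpow_add_of_nonneg _ _ (by positivity) zero_le_one, h]
  calc _ ≤ (A ^ r * ∫⁻ y, g y ^ r ∂ν) ^ (1 / r) := by gcongr
    _ = _ := by
      rw [ENNReal.mul_rpow_of_nonneg _ _ (by positivity), ← ENNReal.rpow_mul,
        mul_one_div_cancel hr0.ne', ENNReal.rpow_one]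

/-- Monotone convergence for finite `p`, a countable union of null sets for `p = ∞`. It reduces the
maximal function to suprema over `N ≤ M`, for which finitely many characters matter. -/
theorem eLpNorm_iSup_le_of_monotone {X : Type*} [MeasurableSpace X] {μ : Measure X}
    {g : ℕ → X → ℝ≥0∞} (hg : ∀ n, Measurable (g n)) (hmono : Monotone g) {p B : ℝ≥0∞}
    (h : ∀ n, eLpNorm (g n) p μ ≤ B) : eLpNorm (fun x => ⨆ n, g n x) p μ ≤ B := by
  rcases eq_or_ne p 0 with rfl | hp0
  · simp
  rcases eq_or_ne p ∞ with rfl | hp'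
  · simp only [eLpNorm_exponent_top] at h ⊢
    refine essSup_le_of_ae_le _ ?_
    filter_upwards [ae_all_iff.2 fun n => enorm_ae_le_eLpNormEssSup (g n) μ] with x hx
    exact iSup_le fun n => (hx n).trans (h n)
  have hr : 0 < p.toReal := ENNReal.toReal_pos hp0 hp'
  have h' : ∀ n, ∫⁻ x, g n x ^ p.toReal ∂μ ≤ B ^ p.toReal := fun n => by
    have := h n
    rw [eLpNorm_eq_lintegral_rpow_enorm_toReal hp0 hp', one_div, ENNReal.rpow_inv_le_iff hr] at this
    exact this
  rw [eLpNorm_eq_lintegral_rpow_enorm_toReal hp0 hp', one_div, ENNReal.rpow_inv_le_iff hr]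
  have e : ∀ x, (⨆ n, g n x) ^ p.toReal = ⨆ n, g n x ^ p.toReal := fun x =>
    (ENNReal.orderIsoRpow p.toReal hr).map_iSup _
  simp only [enorm_eq_self, e]
  rw [lintegral_iSup (fun n => (hg n).pow_const _)
    fun m n hmn x => ENNReal.rpow_le_rpow (hmono hmn x) hr.le]
  exact iSup_le h'

/-! ### Trigonometric polynomials -/

section TrigPoly

variable {G : Type*} [CommGroup G] [TopologicalSpace G]

theorem continuous_coe_pontryaginDual (γ : PontryaginDual G) :
    Continuous fun x => (γ x : ℂ) :=
  continuous_subtype_val.comp (map_continuous γ)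

variable (G) in
/-- The trigonometric polynomials on `G`: the linear span of the characters. -/
def trigPoly : Submodule ℂ (G → ℂ) :=
  Submodule.span ℂ (Set.range fun (γ : PontryaginDual G) (x : G) => (γ x : ℂ))

theorem character_mem_trigPoly (γ : PontryaginDual G) : (fun x => (γ x : ℂ)) ∈ trigPoly G :=
  Submodule.subset_span ⟨γ, rfl⟩

theorem one_mem_trigPoly : (1 : G → ℂ) ∈ trigPoly G := by
  convert character_mem_trigPoly (1 : PontryaginDual G) using 1
  ext x
  simp

theorem mul_mem_trigPoly {P Q : G → ℂ} (hP : P ∈ trigPoly G) (hQ : Q ∈ trigPoly G) :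
    P * Q ∈ trigPoly G := by
  have := Submodule.mul_mem_mul hP hQ
  unfold trigPoly at this
  rw [Submodule.span_mul_span] at this
  refine Submodule.span_mono ?_ this
  rintro _ ⟨_, ⟨γ, rfl⟩, _, ⟨γ', rfl⟩, rfl⟩
  exact ⟨γ * γ', by ext x; rfl⟩

theorem pow_mem_trigPoly {P : G → ℂ} (hP : P ∈ trigPoly G) (j : ℕ) : P ^ j ∈ trigPoly G := by
  induction j with
  | zero => simpa using one_mem_trigPoly
  | succ j ih => simpa [pow_succ] using mul_mem_trigPoly ih hP

theorem continuous_of_mem_trigPoly {K : G → ℂ} (hK : K ∈ trigPoly G) : Continuous K := by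
  induction hK using Submodule.span_induction with
  | mem K h =>
    obtain ⟨γ, rfl⟩ := h
    exact continuous_coe_pontryaginDual γ
  | zero => exact continuous_const
  | add K K' _ _ h h' => exact h.add h'
  | smul c K _ h => exact h.const_smul c

/-- Continuity does not suffice, since the Borel σ-algebra of `G × G` may exceed the product
σ-algebra. A character, however, factors into functions of one variable each, and this passes to
linear combinations. -/
theorem measurable_trigPoly_mul_inv [MeasurableSpace G] [BorelSpace G] {K : G → ℂ} (hK : K ∈ trigPoly G) {b : ℝ → G}
    (hb : Continuous b) :
    Measurable fun z : (G × G) × ℝ => K (z.1.1 * b z.2 * z.1.2⁻¹) := by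
  induction hK using Submodule.span_induction with
  | mem K h =>
    obtain ⟨γ, rfl⟩ := h
    have hγ : Measurable fun x => (γ x : ℂ) :=
      (continuous_subtype_val.comp (map_continuous γ)).measurable
    have hγ' : Measurable fun x => (γ (b x) : ℂ) :=
      (continuous_subtype_val.comp ((map_continuous γ).comp hb)).measurable
    simp only [map_mul, map_inv, Circle.coe_mul, Circle.coe_inv]
    exact ((hγ.comp (measurable_fst.comp measurable_fst)).mul (hγ'.comp measurable_snd)).mul
      (hγ.comp (measurable_snd.comp measurable_fst)).inv
  | zero => exact measurable_const
  | add K K' _ _ h h' => exact h.add h'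
  | smul c K _ h => exact h.const_smul c

end TrigPoly

/-! ### Orthogonality and approximate identities on a compact abelian group -/

section CompactGroup

variable {G : Type*} [CommGroup G] [TopologicalSpace G] [IsTopologicalGroup G] [CompactSpace G]
  [MeasurableSpace G] [BorelSpace G]

instance : (normalizedHaar G).IsHaarMeasure := by
  unfold normalizedHaar
  infer_instance

instance : (normalizedHaar G).Regular := by
  unfold normalizedHaar
  infer_instance

instance : IsProbabilityMeasure (normalizedHaar G) where
  measure_univ := by
    have := Measure.haarMeasure_self (K₀ := (⊤ : TopologicalSpace.PositiveCompacts G))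
    simpa [normalizedHaar] using this

/-- Translating by a point where the two characters differ multiplies the integral by a number other
than `1`. -/
theorem charFourierCoeff_character [DecidableEq (PontryaginDual G)] (γ γ' : PontryaginDual G) :
    charFourierCoeff (fun x => (γ x : ℂ)) γ' = if γ = γ' then 1 else 0 := by
  unfold charFourierCoeff
  split_ifs with h
  · subst h
    simp [Complex.mul_conj]
  · obtain ⟨x, hx⟩ : ∃ x, γ x ≠ γ' x := by
      by_contra! H
      exact h (PontryaginDual.ext H)
    set I := ∫ ω, (γ ω : ℂ) * conj (γ' ω : ℂ) ∂(normalizedHaar G) with hI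
    have h1 : I = (γ x : ℂ) * conj (γ' x : ℂ) * I := by
      conv_lhs => rw [hI, ← integral_mul_left_eq_self _ x]
      rw [hI, ← integral_const_mul]
      congr 1
      ext ω
      simp only [map_mul, Circle.coe_mul]
      ring
    by_contra h0
    have h2 : (γ x : ℂ) * conj (γ' x : ℂ) = 1 := by
      have h3 : (1 : ℂ) * I = (γ x : ℂ) * conj (γ' x : ℂ) * I := by rw [one_mul]; exact h1
      exact (mul_right_cancel₀ h0 h3).symm
    rw [← Circle.coe_inv_eq_conj, ← Circle.coe_mul] at h2
    have h4 : γ x * (γ' x)⁻¹ = 1 := Circle.ext (by simpa using h2)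
    exact hx (mul_inv_eq_one.1 h4)

theorem integrable_mul_of_continuous {f K : G → ℂ} (hf : Integrable f (normalizedHaar G))
    (hK : Continuous K) : Integrable (fun η => f η * K η) (normalizedHaar G) := by
  obtain ⟨C, hC⟩ := isCompact_univ.exists_bound_of_continuousOn hK.continuousOn
  exact hf.mul_bdd (c := C) hK.measurable.aestronglyMeasurable
    (ae_of_all _ fun x => hC x (Set.mem_univ x))

/-- High powers of a function peaking at the identity, normalised in `L_1`. The peak function `1 -
v` is built from the finitely many given characters, so concentration where they are close to `1` is
all that is needed, and no neighbourhood basis of the identity appears. -/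
theorem exists_trigPoly_approx_identity (χ : ℕ → PontryaginDual G) (M : ℕ) {ε : ℝ} (hε : 0 < ε) :
    ∃ K ∈ trigPoly G, ∫⁻ x, ‖K x‖ₑ ∂(normalizedHaar G) = 1 ∧
      ∀ n < M, ‖1 - charFourierCoeff K (χ n)‖ ≤ ε := by
  set μ := normalizedHaar G with hμ
  set v : G → ℝ := fun x => (2 * M : ℝ)⁻¹ * ∑ n ∈ Finset.range M, (1 - (χ n x : ℂ).re) with hv
  have hre : ∀ n x, (χ n x : ℂ).re ≤ 1 := fun n x =>
    (Complex.re_le_norm _).trans (Circle.norm_coe _).le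
  have hre' : ∀ n x, -1 ≤ (χ n x : ℂ).re := fun n x => by
    have := (abs_le.1 (Complex.abs_re_le_norm (χ n x : ℂ))).1
    rwa [Circle.norm_coe] at this
  have hv0 : ∀ x, 0 ≤ v x := fun x =>
    mul_nonneg (by positivity) (Finset.sum_nonneg fun n _ => by linarith [hre n x])
  have hv1 : ∀ x, v x ≤ 1 := fun x => by
    have : ∑ n ∈ Finset.range M, (1 - (χ n x : ℂ).re) ≤ 2 * M := by
      refine (Finset.sum_le_card_nsmul _ _ 2 fun n _ => by linarith [hre' n x]).trans ?_
      simp [mul_comm]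
    exact inv_mul_le_one_of_le₀ this (by positivity)
  have hvn : ∀ n < M, ∀ x, 1 - (χ n x : ℂ).re ≤ 2 * M * v x := fun n hn x => by
    have hM : (2 * M : ℝ) ≠ 0 := by
      have : 0 < M := by omega
      positivity
    simp only [hv]
    rw [mul_inv_cancel_left₀ hM]
    exact Finset.single_le_sum (f := fun n => 1 - (χ n x : ℂ).re)
      (fun n _ => by linarith [hre n x]) (Finset.mem_range.2 hn)
  have hvc : Continuous v := by
    refine continuous_const.mul (continuous_finsetSum _ fun n _ => continuous_const.sub ?_)
    exact Complex.continuous_re.comp (continuous_coe_pontryaginDual _)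
  have hint : ∀ g : G → ℝ, Continuous g → Integrable g μ := fun g hg =>
    hg.integrable_of_hasCompactSupport (HasCompactSupport.of_compactSpace g)
  set I : ℕ → ℝ := fun j => ∫ x, (1 - v x) ^ j ∂μ with hI
  have hsucc : ∀ j, I (j + 1) = I j - ∫ x, v x * (1 - v x) ^ j ∂μ := fun j => by
    simp only [hI]
    rw [← integral_sub (hint _ (by fun_prop)) (hint _ (by fun_prop))]
    congr 1
    ext x
    ring
  have hlow : ∀ δ : ℝ, 0 < δ → δ ≤ 1 → ∀ j, (1 - δ) ^ j * μ.real {x | v x < δ} ≤ I j := by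
    intro δ hδ hδ1 j
    have hms : MeasurableSet {x | v x < δ} := (isOpen_lt hvc continuous_const).measurableSet
    calc (1 - δ) ^ j * μ.real {x | v x < δ} = ∫ x in {x | v x < δ}, (1 - δ) ^ j ∂μ := by
          rw [setIntegral_const, smul_eq_mul, mul_comm]
      _ ≤ ∫ x in {x | v x < δ}, (1 - v x) ^ j ∂μ := by
          refine setIntegral_mono_on (integrable_const _).integrableOn
            (hint _ (by fun_prop)).integrableOn hms fun x hx => ?_
          have hx : v x < δ := hx
          exact pow_le_pow_left₀ (by linarith) (by linarith) j
      _ ≤ _ := setIntegral_le_integral (hint _ (by fun_prop))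
          (ae_of_all _ fun x => pow_nonneg (by linarith [hv1 x]) j)
  have hposm : ∀ δ : ℝ, 0 < δ → 0 < μ.real {x | v x < δ} := fun δ hδ => by
    refine ENNReal.toReal_pos ?_ (measure_ne_top _ _)
    refine ((isOpen_lt hvc continuous_const).measure_pos μ ⟨1, ?_⟩).ne'
    simpa [hv] using hδ
  have hIpos : ∀ j, 0 < I j := fun j =>
    (mul_pos (by positivity) (hposm (1 / 2) (by norm_num))).trans_le
      (hlow (1 / 2) (by norm_num) (by norm_num) j)
  -- If the mean of `v` exceeded `δ` for every power, `I j` would decay like `(1 - δ)^j`; but the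
  -- open set `{v < δ/2}` has positive measure and forces `I j ≥ const · (1 - δ/2)^j`.
  have hconc : ∀ δ : ℝ, 0 < δ → δ < 1 → ∃ j, ∫ x, v x * (1 - v x) ^ j ∂μ ≤ δ * I j := by
    intro δ hδ hδ1
    by_contra! H
    have hup : ∀ j, I j ≤ (1 - δ) ^ j := by
      intro j
      induction j with
      | zero => simp [hI]
      | succ j ih =>
        rw [hsucc, pow_succ]
        have := H j
        nlinarith
    have hlow' := hlow (δ / 2) (by linarith) (by linarith)
    have hc := hposm (δ / 2) (by linarith)
    set c := μ.real {x | v x < δ / 2}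
    have hq : (1 - δ) / (1 - δ / 2) < 1 := (div_lt_one (by linarith)).2 (by linarith)
    obtain ⟨j, hj⟩ := exists_pow_lt_of_lt_one hc hq
    rw [div_pow, div_lt_iff₀ (pow_pos (by linarith) j)] at hj
    linarith [hup j, hlow' j]
  -- Chosen for the final estimate: `‖1 - χ‖ ≤ ε/2 + (2M/ε) v` integrates to at most `ε/2 + 2Mδ/ε ≤
  -- ε`.
  set δ := min (1 / 2) (ε ^ 2 / (4 * M + 4)) with hδ
  obtain ⟨j, hj⟩ := hconc δ (lt_min (by norm_num) (by positivity))
    ((min_le_left _ _).trans_lt (by norm_num))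
  set W : G → ℝ := fun x => (I j)⁻¹ * (1 - v x) ^ j with hW
  have hWc : Continuous W := by fun_prop
  have hW0 : ∀ x, 0 ≤ W x := fun x =>
    mul_nonneg (inv_nonneg.2 (hIpos j).le) (pow_nonneg (by linarith [hv1 x]) j)
  have hWI : ∫ x, W x ∂μ = 1 := by
    simp only [hW]
    rw [integral_const_mul]
    exact inv_mul_cancel₀ (hIpos j).ne'
  have hWv : ∫ x, v x * W x ∂μ ≤ δ := by
    have : ∫ x, v x * W x ∂μ = (I j)⁻¹ * ∫ x, v x * (1 - v x) ^ j ∂μ := by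
      rw [← integral_const_mul]
      congr 1
      ext x
      simp only [hW]
      ring
    rw [this, inv_mul_le_iff₀ (hIpos j), mul_comm]
    exact hj
  refine ⟨fun x => (W x : ℂ), ?_, ?_, fun n hn => ?_⟩
  · have hvm : (fun x => (v x : ℂ)) ∈ trigPoly G := by
      have : (fun x => (v x : ℂ)) = ((2 * M : ℂ)⁻¹) • ∑ n ∈ Finset.range M,
          ((1 : G → ℂ) - (1 / 2 : ℂ) • ((fun x => (χ n x : ℂ)) + fun x => ((χ n)⁻¹ x : ℂ))) := by
        ext x
        have hinv : ∀ n, (((χ n)⁻¹ x : Circle) : ℂ) = conj (χ n x : ℂ) := fun n =>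
          Circle.coe_inv_eq_conj (χ n x)
        simp only [hv, Pi.smul_apply, Finset.sum_apply, Pi.sub_apply, Pi.add_apply, Pi.one_apply,
          smul_eq_mul, hinv, Complex.add_conj]
        push_cast
        congr 1
        refine Finset.sum_congr rfl fun n _ => ?_
        ring
      rw [this]
      exact Submodule.smul_mem _ _ (Submodule.sum_mem _ fun n _ => Submodule.sub_mem _
        one_mem_trigPoly (Submodule.smul_mem _ _ (Submodule.add_mem _
          (character_mem_trigPoly _) (character_mem_trigPoly _))))
    have : (fun x => (W x : ℂ)) = ((I j : ℂ)⁻¹) • ((1 : G → ℂ) - fun x => (v x : ℂ)) ^ j := by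
      ext x
      simp [hW]
    rw [this]
    exact Submodule.smul_mem _ _ (pow_mem_trigPoly (Submodule.sub_mem _ one_mem_trigPoly hvm) j)
  · have : ∀ x, ‖(W x : ℂ)‖ₑ = ENNReal.ofReal (W x) := fun x => by
      rw [← ofReal_norm, Complex.norm_real, Real.norm_of_nonneg (hW0 x)]
    simp only [this]
    rw [← ofReal_integral_eq_lintegral_ofReal (hint W hWc) (ae_of_all _ hW0), hWI,
      ENNReal.ofReal_one]
  · have hχc := continuous_coe_pontryaginDual (χ n)
    have hintc : ∀ g : G → ℂ, Continuous g → Integrable g μ := fun g hg =>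
      hg.integrable_of_hasCompactSupport (HasCompactSupport.of_compactSpace g)
    have h1 : 1 - charFourierCoeff (fun x => (W x : ℂ)) (χ n) =
        ∫ x, (W x : ℂ) * (1 - conj (χ n x : ℂ)) ∂μ := by
      have e : (1 : ℂ) = ∫ x, (W x : ℂ) ∂μ := by
        rw [integral_complex_ofReal, hWI, Complex.ofReal_one]
      unfold charFourierCoeff
      rw [← hμ]
      conv_lhs => rw [e]
      rw [← integral_sub (hintc _ (by fun_prop)) (hintc _ (by fun_prop))]
      congr 1
      ext x
      ring
    -- From `‖1 - χ‖² = 2(1 - Re χ) ≤ 4Mv` and `2εy ≤ ε² + y²`.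
    have hnorm : ∀ x, ‖1 - conj (χ n x : ℂ)‖ ≤ ε / 2 + 2 * M / ε * v x := fun x => by
      have hsq : ‖1 - conj (χ n x : ℂ)‖ ^ 2 = 2 * (1 - (χ n x : ℂ).re) := by
        have hu : Complex.normSq (χ n x : ℂ) = 1 := Circle.normSq_coe _
        rw [Complex.sq_norm, Complex.normSq_sub]
        simp [hu]
        ring
      have hle := hvn n hn x
      set y := ‖1 - conj (χ n x : ℂ)‖
      have : ε * (ε / 2 + 2 * M / ε * v x) = ε ^ 2 / 2 + 2 * M * v x := by
        field_simp
      refine le_of_mul_le_mul_left ?_ hε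
      rw [this]
      nlinarith [sq_nonneg (y - ε)]
    rw [h1]
    calc ‖∫ x, (W x : ℂ) * (1 - conj (χ n x : ℂ)) ∂μ‖
        ≤ ∫ x, (ε / 2 * W x + 2 * M / ε * (v x * W x)) ∂μ := by
          refine norm_integral_le_of_norm_le (hint _ (by fun_prop)) (ae_of_all _ fun x => ?_)
          rw [norm_mul, Complex.norm_real, Real.norm_of_nonneg (hW0 x)]
          calc W x * ‖1 - conj (χ n x : ℂ)‖ ≤ W x * (ε / 2 + 2 * M / ε * v x) :=
                mul_le_mul_of_nonneg_left (hnorm x) (hW0 x)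
            _ = _ := by ring
      _ = ε / 2 + 2 * M / ε * ∫ x, v x * W x ∂μ := by
          rw [integral_add (hint _ (by fun_prop)) (hint _ (by fun_prop)),
            integral_const_mul (ε / 2) W, integral_const_mul _ fun x => v x * W x, hWI, mul_one]
      _ ≤ ε / 2 + 2 * M / ε * (ε ^ 2 / (4 * M + 4)) := by
          gcongr
          exact hWv.trans (min_le_right _ _)
      _ ≤ ε := by
          have : 2 * M / ε * (ε ^ 2 / (4 * M + 4)) = ε / 2 * (M / (M + 1)) := by
            field_simp
            ring
          rw [this]
          have h2 : (M : ℝ) / (M + 1) ≤ 1 := (div_le_one (by positivity)).2 (by linarith)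
          nlinarith

end CompactGroup

/-! ### Averages along the flow -/

section LambdaDirichletGroup

variable {G : Type*} [CommGroup G] [TopologicalSpace G]

/-- At time `π / (λ_n - λ_m)` the two characters would differ by the factor `-1`. -/
theorem IsLambdaDirichletGroup.character_injective {lam : ℕ → ℝ} (hlam : IsFrequency lam)
    {β : Multiplicative ℝ →* G} (hβ : IsLambdaDirichletGroup lam β) :
    Function.Injective hβ.character := by
  intro n m h
  by_contra hnm
  have hne : lam n - lam m ≠ 0 := sub_ne_zero.2 fun e => hnm (hlam.strictMono.injective e)
  have h1 := hβ.character_spec n (Real.pi / (lam n - lam m))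
  have h2 := hβ.character_spec m (Real.pi / (lam n - lam m))
  rw [h, h2] at h1
  have h3 : Complex.exp (-(Complex.I * lam m * ↑(Real.pi / (lam n - lam m)))) =
      -Complex.exp (-(Complex.I * lam m * ↑(Real.pi / (lam n - lam m)))) := by
    conv_lhs => rw [h1]
    have hne' : (lam n - lam m : ℂ) ≠ 0 := by exact_mod_cast hne
    have e : -(Complex.I * lam n * ↑(Real.pi / (lam n - lam m))) =
        -(Complex.I * lam m * ↑(Real.pi / (lam n - lam m))) - Real.pi * Complex.I := by
      push_cast
      field_simp
      ring
    rw [e, Complex.exp_sub, Complex.exp_pi_mul_I, div_neg, div_one]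
  exact Complex.exp_ne_zero _ (self_eq_neg.1 h3)

theorem IsLambdaDirichletGroup.character_flow {lam : ℕ → ℝ} {β : Multiplicative ℝ →* G}
    (hβ : IsLambdaDirichletGroup lam β) (n : ℕ) (s : ℝ) :
    (hβ.character n (β (Multiplicative.ofAdd (-(2 * Real.pi * s)))) : ℂ) =
      Complex.exp (2 * Real.pi * Complex.I * lam n * s) := by
  rw [hβ.character_spec n]
  congr 1
  push_cast
  ring

theorem IsDirichletGroup.continuous_flow {β : Multiplicative ℝ →* G} (hβ : IsDirichletGroup β) :
    Continuous fun s : ℝ => β (Multiplicative.ofAdd (-(2 * Real.pi * s))) :=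
  hβ.continuous.comp (continuous_ofAdd.comp (by fun_prop))

/-- The average over the flow, with weight `Φ`, of the translates of `‖K‖`. -/
noncomputable def flowKernel (β : Multiplicative ℝ →* G) (Φ : ℝ → ℝ) (K : G → ℂ) (ω η : G) :
    ℝ≥0∞ :=
  ∫⁻ s, ENNReal.ofReal (Φ s) *
    ‖K (ω * β (Multiplicative.ofAdd (-(2 * Real.pi * s))) * η⁻¹)‖ₑ

theorem measurable_flowKernel_integrand [MeasurableSpace G] [BorelSpace G]
    {β : Multiplicative ℝ →* G} (hβ : IsDirichletGroup β)
    {Φ : ℝ → ℝ} (hΦ : Measurable Φ) {K : G → ℂ} (hK : K ∈ trigPoly G) :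
    Measurable fun z : (G × G) × ℝ => ENNReal.ofReal (Φ z.2) *
      ‖K (z.1.1 * β (Multiplicative.ofAdd (-(2 * Real.pi * z.2))) * z.1.2⁻¹)‖ₑ :=
  (hΦ.comp measurable_snd).ennreal_ofReal.mul
    (measurable_trigPoly_mul_inv hK hβ.continuous_flow).enorm

theorem measurable_flowKernel [MeasurableSpace G] [BorelSpace G] {β : Multiplicative ℝ →* G}
    (hβ : IsDirichletGroup β) {Φ : ℝ → ℝ} (hΦ : Measurable Φ) {K : G → ℂ} (hK : K ∈ trigPoly G) :
    Measurable (Function.uncurry (flowKernel β Φ K)) :=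
  (measurable_flowKernel_integrand hβ hΦ hK).lintegral_prod_right'

variable [IsTopologicalGroup G] [CompactSpace G] [MeasurableSpace G] [BorelSpace G]

/-- A multiplier of the partial sums of a smoothed function is an average along the flow. -/
theorem sum_charFourierCoeff_mul_eq_integral_flow {lam : ℕ → ℝ} (hlam : IsFrequency lam)
    {β : Multiplicative ℝ →* G} (hβ : IsLambdaDirichletGroup lam β) {k : ℝ → ℂ}
    (hk : Integrable k) {N : ℕ} {c : ℕ → ℂ}
    (hlt : ∀ n < N, ∫ s, k s * Complex.exp (2 * Real.pi * Complex.I * lam n * s) = c n)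
    (hge : ∀ n, N ≤ n → ∫ s, k s * Complex.exp (2 * Real.pi * Complex.I * lam n * s) = 0)
    {f : G → ℂ} (hf : Integrable f (normalizedHaar G))
    (hf0 : ∀ γ : PontryaginDual G, (∀ n, γ ≠ hβ.character n) → charFourierCoeff f γ = 0)
    {K : G → ℂ} (hK : K ∈ trigPoly G) (ω : G) :
    ∑ n ∈ Finset.range N, charFourierCoeff K (hβ.character n) *
      (charFourierCoeff f (hβ.character n) * c n * (hβ.character n ω : ℂ)) =
    ∫ s, k s * ∫ η, f η * K (ω * β (Multiplicative.ofAdd (-(2 * Real.pi * s))) * η⁻¹)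
      ∂(normalizedHaar G) := by
  classical
  set b : ℝ → G := fun s => β (Multiplicative.ofAdd (-(2 * Real.pi * s))) with hb
  have hbc : Continuous b := hβ.toIsDirichletGroup.continuous_flow
  have hin : ∀ K ∈ trigPoly G, ∀ s, Integrable (fun η => f η * K (ω * b s * η⁻¹))
      (normalizedHaar G) := fun K hK s =>
    integrable_mul_of_continuous hf ((continuous_of_mem_trigPoly hK).comp (by fun_prop))
  have hKin : ∀ K ∈ trigPoly G, ∀ n, Integrable
      (fun ω => K ω * conj (hβ.character n ω : ℂ)) (normalizedHaar G) := fun K hK n => by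
    have h1 := continuous_of_mem_trigPoly hK
    have h2 := continuous_coe_pontryaginDual (hβ.character n)
    exact Continuous.integrable_of_hasCompactSupport (by fun_prop)
      (HasCompactSupport.of_compactSpace _)
  -- Integrability in `s` is carried through the induction because additivity of the integral needs
  -- it.
  suffices H : Integrable (fun s => k s * ∫ η, f η * K (ω * b s * η⁻¹) ∂(normalizedHaar G)) ∧
      ∑ n ∈ Finset.range N, charFourierCoeff K (hβ.character n) *
        (charFourierCoeff f (hβ.character n) * c n * (hβ.character n ω : ℂ)) =
      ∫ s, k s * ∫ η, f η * K (ω * b s * η⁻¹) ∂(normalizedHaar G) from H.2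
  induction hK using Submodule.span_induction with
  | mem K h =>
    obtain ⟨γ, rfl⟩ := h
    have hγc : Continuous fun s => (γ (b s) : ℂ) := (continuous_coe_pontryaginDual γ).comp hbc
    have e : ∀ s, k s * ∫ η, f η * (γ (ω * b s * η⁻¹) : ℂ) ∂(normalizedHaar G) =
        (charFourierCoeff f γ * (γ ω : ℂ)) * (k s * (γ (b s) : ℂ)) := fun s => by
      have : ∀ η, f η * (γ (ω * b s * η⁻¹) : ℂ) =
          ((γ ω : ℂ) * (γ (b s) : ℂ)) * (f η * conj (γ η : ℂ)) := fun η => by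
        rw [map_mul, map_mul, map_inv, Circle.coe_mul, Circle.coe_mul, Circle.coe_inv_eq_conj]
        ring
      simp only [this]
      rw [integral_const_mul, ← charFourierCoeff]
      ring
    simp only [e, charFourierCoeff_character]
    refine ⟨Integrable.const_mul ?_ _, ?_⟩
    · exact hk.mul_bdd (c := 1) hγc.aestronglyMeasurable (ae_of_all _ fun s => by
        rw [Circle.norm_coe])
    rw [integral_const_mul]
    -- For `γ = h_{λ_m}` orthogonality leaves at most the term `n = m`; for any other `γ` the
    -- spectral condition on `f` kills both sides.
    by_cases hγ : ∃ m, γ = hβ.character m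
    · obtain ⟨m, rfl⟩ := hγ
      have hinj : ∀ n, hβ.character m = hβ.character n ↔ m = n := fun n =>
        (hβ.character_injective hlam).eq_iff
      simp only [hinj, hb, hβ.character_flow]
      simp only [ite_mul, one_mul, zero_mul, Finset.sum_ite_eq, Finset.mem_range]
      split_ifs with hm
      · rw [hlt m hm]
        ring
      · rw [hge m (not_lt.1 hm), mul_zero]
    · push Not at hγ
      rw [hf0 γ hγ]
      simp [hγ]
  | zero => simp [charFourierCoeff]
  | add K K' hK hK' h h' =>
    have e : ∀ s, k s * ∫ η, f η * (K + K') (ω * b s * η⁻¹) ∂(normalizedHaar G) =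
        (k s * ∫ η, f η * K (ω * b s * η⁻¹) ∂(normalizedHaar G)) +
        (k s * ∫ η, f η * K' (ω * b s * η⁻¹) ∂(normalizedHaar G)) := fun s => by
      rw [← mul_add, ← integral_add (hin K hK s) (hin K' hK' s)]
      simp only [Pi.add_apply, mul_add]
    have e' : ∀ n, charFourierCoeff (K + K') (hβ.character n) =
        charFourierCoeff K (hβ.character n) + charFourierCoeff K' (hβ.character n) := fun n => by
      unfold charFourierCoeff
      rw [← integral_add (hKin K hK n) (hKin K' hK' n)]
      simp only [Pi.add_apply, add_mul]
    simp only [e, e', add_mul, Finset.sum_add_distrib]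
    exact ⟨h.1.add h'.1, by rw [integral_add h.1 h'.1, h.2, h'.2]⟩
  | smul a K hK h =>
    have e : ∀ s, k s * ∫ η, f η * (a • K) (ω * b s * η⁻¹) ∂(normalizedHaar G) =
        a * (k s * ∫ η, f η * K (ω * b s * η⁻¹) ∂(normalizedHaar G)) := fun s => by
      rw [mul_left_comm, ← integral_const_mul a]
      congr 2
      ext η
      simp only [Pi.smul_apply, smul_eq_mul, mul_left_comm]
    have e' : ∀ n, charFourierCoeff (a • K) (hβ.character n) =
        a * charFourierCoeff K (hβ.character n) := fun n => by
      unfold charFourierCoeff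
      rw [← integral_const_mul]
      simp only [Pi.smul_apply, smul_eq_mul, mul_assoc]
    simp only [e, e', mul_assoc a, ← Finset.mul_sum]
    exact ⟨h.1.const_mul a, by rw [integral_const_mul, ← h.2]⟩

theorem enorm_charFourierCoeff_le (f : G → ℂ) (γ : PontryaginDual G) :
    ‖charFourierCoeff f γ‖ₑ ≤ ∫⁻ ω, ‖f ω‖ₑ ∂(normalizedHaar G) := by
  refine (enorm_integral_le_lintegral_enorm _).trans (le_of_eq ?_)
  congr 1
  ext ω
  have h : ‖(((γ ω)⁻¹ : Circle) : ℂ)‖ₑ = 1 := by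
    rw [← ofReal_norm, Circle.norm_coe, ENNReal.ofReal_one]
  rw [← Circle.coe_inv_eq_conj, enorm_mul, h, mul_one]

theorem lintegral_flowKernel_left {β : Multiplicative ℝ →* G} (hβ : IsDirichletGroup β)
    {Φ : ℝ → ℝ} (hΦ : Measurable Φ) {K : G → ℂ} (hK : K ∈ trigPoly G) (η : G) :
    ∫⁻ ω, flowKernel β Φ K ω η ∂(normalizedHaar G) =
      (∫⁻ s, ENNReal.ofReal (Φ s)) * ∫⁻ x, ‖K x‖ₑ ∂(normalizedHaar G) := by
  have hKm := (continuous_of_mem_trigPoly hK).measurable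
  unfold flowKernel
  rw [lintegral_lintegral_swap, ← lintegral_mul_const _ hΦ.ennreal_ofReal]
  · congr 1
    ext s
    rw [lintegral_const_mul _ (by fun_prop)]
    simp only [mul_assoc]
    rw [lintegral_mul_right_eq_self fun x => ‖K x‖ₑ]
  · exact ((measurable_flowKernel_integrand hβ hΦ hK).comp
      (f := fun z : G × ℝ => ((z.1, η), z.2)) (by fun_prop)).aemeasurable

/-- Here inversion invariance of Haar measure is needed besides translation invariance. With the
other marginal this supplies both hypotheses of Schur's test with the same constant. -/
theorem lintegral_flowKernel_right {β : Multiplicative ℝ →* G} (hβ : IsDirichletGroup β)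
    {Φ : ℝ → ℝ} (hΦ : Measurable Φ) {K : G → ℂ} (hK : K ∈ trigPoly G) (ω : G) :
    ∫⁻ η, flowKernel β Φ K ω η ∂(normalizedHaar G) =
      (∫⁻ s, ENNReal.ofReal (Φ s)) * ∫⁻ x, ‖K x‖ₑ ∂(normalizedHaar G) := by
  have hKm := (continuous_of_mem_trigPoly hK).measurable
  unfold flowKernel
  rw [lintegral_lintegral_swap, ← lintegral_mul_const _ hΦ.ennreal_ofReal]
  · congr 1
    ext s
    rw [lintegral_const_mul _ (by fun_prop)]
    simp only [← div_eq_mul_inv]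
    rw [lintegral_div_left_eq_self fun x => ‖K x‖ₑ]
  · exact ((measurable_flowKernel_integrand hβ hΦ hK).comp
      (f := fun z : G × ℝ => ((ω, z.1), z.2)) (by fun_prop)).aemeasurable

/-- The right-hand side involves only the majorant `Φ`, not `k`, so the same bound serves all
partial sums at once. -/
theorem enorm_integral_flow_le {β : Multiplicative ℝ →* G} (hβ : IsDirichletGroup β)
    {Φ : ℝ → ℝ} (hΦ : Measurable Φ) {k : ℝ → ℂ} (hk : ∀ s, ‖k s‖ ≤ Φ s) {K : G → ℂ}
    (hK : K ∈ trigPoly G) {f : G → ℂ} (hf : Measurable f) (ω : G) :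
    ‖∫ s, k s * ∫ η, f η * K (ω * β (Multiplicative.ofAdd (-(2 * Real.pi * s))) * η⁻¹)
      ∂(normalizedHaar G)‖ₑ ≤
    ∫⁻ η, flowKernel β Φ K ω η * ‖f η‖ₑ ∂(normalizedHaar G) := by
  have hKm := (continuous_of_mem_trigPoly hK).measurable
  have hm := (measurable_flowKernel_integrand hβ hΦ hK).comp
      (f := fun z : G × ℝ => ((ω, z.1), z.2)) (by fun_prop)
  have e : ∀ η, flowKernel β Φ K ω η * ‖f η‖ₑ = ∫⁻ s, ENNReal.ofReal (Φ s) *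
      ‖K (ω * β (Multiplicative.ofAdd (-(2 * Real.pi * s))) * η⁻¹)‖ₑ * ‖f η‖ₑ := fun η =>
    (lintegral_mul_const _ (hm.comp (measurable_prodMk_left (x := η)))).symm
  simp only [e]
  rw [lintegral_lintegral_swap (hm.mul (hf.enorm.comp measurable_fst)).aemeasurable]
  refine (enorm_integral_le_lintegral_enorm _).trans (lintegral_mono fun s => ?_)
  simp only [mul_assoc (ENNReal.ofReal _)]
  rw [enorm_mul, lintegral_const_mul _ (by fun_prop)]
  refine mul_le_mul' ?_ ((enorm_integral_le_lintegral_enorm _).trans (le_of_eq ?_))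
  · rw [← ofReal_norm]
    exact ENNReal.ofReal_le_ofReal (hk s)
  · congr 1
    ext η
    rw [enorm_mul, mul_comm]

end LambdaDirichletGroup

/-! ### Bohr's condition and the maximal inequality -/

/-- Truncations of `n ↦ e^{-u lam n}` are Fourier transforms of kernels on `ℝ` with a common
integrable majorant, if `lam` satisfies Bohr's condition. -/
theorem BohrCondition.exists_kernel {lam : ℕ → ℝ} (hlam : IsFrequency lam)
    (hBC : BohrCondition lam) {u : ℝ} (hu : 0 < u) :
    ∃ Φ : ℝ → ℝ, Integrable Φ ∧ Continuous Φ ∧ (∀ s, 0 ≤ Φ s) ∧ ∀ N, ∃ k : ℝ → ℂ,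
      Integrable k ∧ (∀ s, ‖k s‖ ≤ Φ s) ∧
      (∀ n < N, ∫ s, k s * Complex.exp (2 * Real.pi * Complex.I * lam n * s) =
        Real.exp (-(lam n * u))) ∧
      ∀ n, N ≤ n → ∫ s, k s * Complex.exp (2 * Real.pi * Complex.I * lam n * s) = 0 := by
  obtain ⟨l, hl, hBC⟩ := hBC
  obtain ⟨c, hc, hgap⟩ := hBC 1 one_pos
  -- Enlarging `l + 1` to at least `u` and shrinking `c` to at most `1` only shortens the ramp, so
  -- it still fits into Bohr's gap.
  obtain ⟨Φ, hΦi, hΦc, hΦ0, hΦ⟩ := exists_kernel_truncating_exp (L := max (l + 1) u) hu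
    (le_max_right _ _) (lt_min hc one_pos) (min_le_right c 1)
  refine ⟨Φ, hΦi, hΦc, hΦ0, fun N => ?_⟩
  -- The empty sum has no last frequency to cut at and gets the zero kernel; otherwise the cut is at
  -- the last retained frequency.
  rcases N with _ | N
  · exact ⟨0, integrable_zero _ _ _, by simpa using hΦ0, by simp, by simp⟩
  obtain ⟨k, hki, hkΦ, hk⟩ := hΦ (lam N) (hlam.nonneg N)
  refine ⟨k, hki, hkΦ, fun n hn => (hk (lam n) (hlam.nonneg n)).1
    (hlam.strictMono.monotone (Nat.lt_succ_iff.1 hn)), fun n hn => (hk (lam n) (hlam.nonneg n)).2 ?_⟩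
  have h1 : lam (N + 1) ≤ lam n := hlam.strictMono.monotone hn
  have h2 : min c 1 * Real.exp (-(max (l + 1) u * lam N)) ≤
      c * Real.exp (-((l + 1) * lam N)) := by
    have := hlam.nonneg N
    gcongr
    · exact min_le_left _ _
    · exact le_max_left _ _
  linarith [hgap N]

/-- The maximal inequality for integrable functions with spectrum in `lam`, from a majorant of
kernels that truncate `n ↦ e^{-u lam n}`. -/
theorem eLpNorm_translatedMaximal_le {G : Type*} [CommGroup G] [TopologicalSpace G]
    [IsTopologicalGroup G] [CompactSpace G] [MeasurableSpace G] [BorelSpace G] {lam : ℕ → ℝ}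
    (hlam : IsFrequency lam) {u : ℝ} (hu : 0 < u) {Φ : ℝ → ℝ} (hΦi : Integrable Φ)
    (hΦc : Continuous Φ) (hΦ0 : ∀ s, 0 ≤ Φ s)
    (hΦ : ∀ N, ∃ k : ℝ → ℂ, Integrable k ∧ (∀ s, ‖k s‖ ≤ Φ s) ∧
      (∀ n < N, ∫ s, k s * Complex.exp (2 * Real.pi * Complex.I * lam n * s) =
        Real.exp (-(lam n * u))) ∧
      ∀ n, N ≤ n → ∫ s, k s * Complex.exp (2 * Real.pi * Complex.I * lam n * s) = 0)
    {β : Multiplicative ℝ →* G} (hβ : IsLambdaDirichletGroup lam β) {p : ℝ≥0∞} (hp : 1 ≤ p)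
    {f : G → ℂ} (hfm : Measurable f) (hfi : Integrable f (normalizedHaar G))
    (hf : ∀ γ : PontryaginDual G, (∀ n, γ ≠ hβ.character n) → charFourierCoeff f γ = 0) :
    eLpNorm (translatedMaximal hβ u f) p (normalizedHaar G) ≤
      ENNReal.ofReal (1 + ∫ s, Φ s) * eLpNorm f p (normalizedHaar G) := by
  have hA : 0 ≤ ∫ s, Φ s := integral_nonneg hΦ0
  set μ := normalizedHaar G with hμ
  set S : ℕ → G → ℂ := fun N ω => ∑ n ∈ Finset.range N, charFourierCoeff f (hβ.character n) *
    (Real.exp (-(lam n * u)) : ℂ) * ((hβ.character n ω : Circle) : ℂ) with hS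
  have hSm : ∀ N, Measurable (S N) := fun N =>
    (continuous_finsetSum _ fun n _ => continuous_const.mul
      (continuous_coe_pontryaginDual (hβ.character n))).measurable
  set g : ℕ → G → ℝ≥0∞ := fun M ω => ⨆ N, ⨆ _ : N ≤ M, ‖S N ω‖ₑ with hg
  have hgm : ∀ M, Measurable (g M) := fun M =>
    Measurable.iSup fun N => Measurable.iSup fun _ => (hSm N).enorm
  have hgmono : Monotone g := fun M M' h ω =>
    iSup_mono fun N => iSup_mono' fun hN => ⟨hN.trans h, le_rfl⟩
  have hmax : translatedMaximal hβ u f = fun ω => ⨆ M, g M ω := by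
    ext ω
    refine le_antisymm (iSup_le fun N => ?_) (iSup_le fun M => iSup₂_le fun N _ => ?_)
    · exact le_iSup_of_le N (le_iSup₂_of_le N le_rfl le_rfl)
    · exact le_iSup (fun N => ‖S N ω‖ₑ) N
  rw [hmax]
  refine eLpNorm_iSup_le_of_monotone hgm hgmono fun M => ?_
  -- With this `ε`, the at most `M` error terms, each bounded by `ε‖f‖_1`, add up to at most
  -- `‖f‖_1`.
  obtain ⟨K, hK, hK1, hKc⟩ := exists_trigPoly_approx_identity hβ.character M
    (ε := 1 / (M + 1)) (by positivity)
  have hΦm := hΦc.measurable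
  have hΦA : ∫⁻ s, ENNReal.ofReal (Φ s) = ENNReal.ofReal (∫ s, Φ s) :=
    (ofReal_integral_eq_lintegral_ofReal hΦi (ae_of_all _ hΦ0)).symm
  set F₁ := ∫⁻ ω, ‖f ω‖ₑ ∂μ with hF₁
  have hpt : ∀ ω, g M ω ≤ F₁ + ∫⁻ η, flowKernel β Φ K ω η * ‖f η‖ₑ ∂μ := by
    intro ω
    refine iSup₂_le fun N hN => ?_
    obtain ⟨k, hki, hkΦ, hlt, hge⟩ := hΦ N
    have hsum := sum_charFourierCoeff_mul_eq_integral_flow hlam hβ hki hlt hge hfi hf hK ω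
    have hflow := enorm_integral_flow_le hβ.toIsDirichletGroup hΦm hkΦ hK hfm ω
    rw [← hsum] at hflow
    have hdec : S N ω = ∑ n ∈ Finset.range N, (1 - charFourierCoeff K (hβ.character n)) *
          (charFourierCoeff f (hβ.character n) * (Real.exp (-(lam n * u)) : ℂ) *
            (hβ.character n ω : ℂ)) +
        ∑ n ∈ Finset.range N, charFourierCoeff K (hβ.character n) *
          (charFourierCoeff f (hβ.character n) * (Real.exp (-(lam n * u)) : ℂ) *
            (hβ.character n ω : ℂ)) := by
      rw [← Finset.sum_add_distrib]
      refine Finset.sum_congr rfl fun n _ => ?_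
      ring
    rw [hdec]
    refine (enorm_add_le _ _).trans (add_le_add ?_ hflow)
    refine (enorm_sum_le _ _).trans ?_
    calc _ ≤ ∑ n ∈ Finset.range N, ENNReal.ofReal (1 / (M + 1)) * F₁ := by
          refine Finset.sum_le_sum fun n hn => ?_
          have hnM : n < M := (Finset.mem_range.1 hn).trans_le hN
          rw [enorm_mul, enorm_mul, enorm_mul]
          have h1 : ‖1 - charFourierCoeff K (hβ.character n)‖ₑ ≤ ENNReal.ofReal (1 / (M + 1)) := by
            rw [← ofReal_norm]
            exact ENNReal.ofReal_le_ofReal (hKc n hnM)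
          have h2 : ‖(Real.exp (-(lam n * u)) : ℂ)‖ₑ ≤ 1 := by
            rw [← ofReal_norm, Complex.norm_real, Real.norm_of_nonneg (Real.exp_nonneg _)]
            refine ENNReal.ofReal_le_one.2 (Real.exp_le_one_iff.2 ?_)
            have := hlam.nonneg n
            nlinarith
          have h3 : ‖(hβ.character n ω : ℂ)‖ₑ = 1 := by
            rw [← ofReal_norm, Circle.norm_coe, ENNReal.ofReal_one]
          rw [h3, mul_one]
          exact mul_le_mul' h1 ((mul_le_mul' (enorm_charFourierCoeff_le f _) h2).trans_eq
            (mul_one _))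
      _ = (N * ENNReal.ofReal (1 / (M + 1))) * F₁ := by
          rw [Finset.sum_const, Finset.card_range, nsmul_eq_mul, mul_assoc]
      _ ≤ 1 * F₁ := by
          refine mul_le_mul' ?_ le_rfl
          rw [← ENNReal.ofReal_natCast, ← ENNReal.ofReal_mul (by positivity)]
          refine ENNReal.ofReal_le_one.2 ?_
          have : (N : ℝ) ≤ M := by exact_mod_cast hN
          rw [mul_one_div, div_le_one (by positivity)]
          linarith
      _ = F₁ := one_mul _
  have hkm := measurable_flowKernel hβ.toIsDirichletGroup hΦm hK
  have hschur := eLpNorm_lintegral_kernel_le (μ := μ) (ν := μ) hkm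
    (A := ENNReal.ofReal (∫ s, Φ s))
    (fun ω => by rw [lintegral_flowKernel_right hβ.toIsDirichletGroup hΦm hK, hK1, hΦA, mul_one])
    (fun η => by rw [lintegral_flowKernel_left hβ.toIsDirichletGroup hΦm hK, hK1, hΦA, mul_one])
    hfm.enorm hp
  rw [eLpNorm_enorm] at hschur
  have hkfm : Measurable fun ω => ∫⁻ η, flowKernel β Φ K ω η * ‖f η‖ₑ ∂μ :=
    Measurable.lintegral_prod_right' (f := fun z : G × G => flowKernel β Φ K z.1 z.2 * ‖f z.2‖ₑ)
      (hkm.mul (hfm.enorm.comp measurable_snd))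
  -- Haar measure has mass one, so the smoothing error contributes exactly the summand `1` of the
  -- constant.
  have hF₁p : F₁ ≤ eLpNorm f p μ := by
    rw [hF₁, ← eLpNorm_one_eq_lintegral_enorm]
    exact eLpNorm_le_eLpNorm_of_exponent_le hp hfm.aestronglyMeasurable
  have hp0 : p ≠ 0 := (zero_lt_one.trans_le hp).ne'
  have hconst : eLpNorm (fun _ : G => F₁) p μ = F₁ := by
    rw [eLpNorm_const _ hp0 (IsProbabilityMeasure.ne_zero μ)]
    simp
  calc eLpNorm (g M) p μ
      ≤ eLpNorm ((fun _ => F₁) + fun ω => ∫⁻ η, flowKernel β Φ K ω η * ‖f η‖ₑ ∂μ) p μ :=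
        eLpNorm_mono_enorm fun ω => by simpa using hpt ω
    _ ≤ eLpNorm (fun _ : G => F₁) p μ +
        eLpNorm (fun ω => ∫⁻ η, flowKernel β Φ K ω η * ‖f η‖ₑ ∂μ) p μ :=
        eLpNorm_add_le measurable_const.aestronglyMeasurable hkfm.aestronglyMeasurable hp
    _ ≤ eLpNorm f p μ + ENNReal.ofReal (∫ s, Φ s) * eLpNorm f p μ := by
        rw [hconst]
        exact add_le_add hF₁p hschur
    _ = _ := by
        rw [ENNReal.ofReal_add zero_le_one hA, ENNReal.ofReal_one, add_mul, one_mul]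

theorem mainTheorem5 (lam : ℕ → ℝ) (hlam : IsFrequency lam) (hBC : BohrCondition lam)
    (u : ℝ) (hu : 0 < u) :
    ∃ C : ℝ, 0 < C ∧
      ∀ (G : Type*) [CommGroup G] [TopologicalSpace G] [IsTopologicalGroup G] [CompactSpace G]
        [T2Space G] [MeasurableSpace G] [BorelSpace G] (β : Multiplicative ℝ →* G)
        (hβ : IsLambdaDirichletGroup lam β) (p : ℝ≥0∞), 1 ≤ p →
        ∀ f : Lp ℂ p (normalizedHaar G), f ∈ hardySpace hβ p →
          eLpNorm (translatedMaximal hβ u f) p (normalizedHaar G) ≤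
            ENNReal.ofReal C * eLpNorm f p (normalizedHaar G) := by
  -- `Φ` lives on `ℝ` and is fixed before `G`, `β` and `p`, which gives the uniformity.
  obtain ⟨Φ, hΦi, hΦc, hΦ0, hΦ⟩ := hBC.exists_kernel hlam hu
  have hA : 0 ≤ ∫ s, Φ s := integral_nonneg hΦ0
  refine ⟨1 + ∫ s, Φ s, by linarith, ?_⟩
  intro G _ _ _ _ _ _ _ β hβ p hp f hf
  exact eLpNorm_translatedMaximal_le hlam hu hΦi hΦc hΦ0 hΦ hβ hp
    (Lp.stronglyMeasurable f).measurable ((Lp.memLp f).integrable hp) hf
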